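/- For a positive integer $d$, let $Q_d$ be the $d$-dimensional hypercube, the graph whose vertices are the binary strings of length $d$, two of them being adjacent when their Hamming distance is one. Graphs are simple. A graph $H$ is a minor of a graph $G$ if $H$ can be obtained (up to isomorphism) from $G$ by a finite sequence of vertex deletions, edge deletions and edge contractions. For a real number $m$, a graph $G$ is called $m$-minor-universal if every graph $H$ with at most $m$ edges and no isolated vertices is a minor of $G$. **Theorem.** There is an absolute constant $c>0$ such that, for every integer $d\ge 1$, the hypercube $Q_d$ is $\frac{c\cdot 2^d}{d}$-minor-universal. -/

import Mathlib

universe u v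

namespace HypercubeMinors

/-- Deletion of the vertex `v` (together with all edges incident to it). -/
def deleteVertex {V : Type u} (G : SimpleGraph V) (v : V) : SimpleGraph {x : V // x ≠ v} :=
  G.induce {x : V | x ≠ v}

/-- Deletion of the edge `e`. -/
def deleteEdge {V : Type u} (G : SimpleGraph V) (e : Sym2 V) : SimpleGraph V :=
  G.deleteEdges {e}

/-- Contraction of the edge `ab`: the vertex `b` is merged into `a`, so that `a` plays the role of
the contracted vertex. Loops and multiple edges are discarded. -/
def contractEdge {V : Type u} (G : SimpleGraph V) (a b : V) : SimpleGraph {x : V // x ≠ b} where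
  Adj x y := x ≠ y ∧
    (G.Adj x y ∨ ((x : V) = a ∧ G.Adj b y) ∨ ((y : V) = a ∧ G.Adj x b))
  symm := ⟨by
    rintro x y ⟨hne, h | ⟨hx, h⟩ | ⟨hy, h⟩⟩
    · exact ⟨hne.symm, Or.inl h.symm⟩
    · exact ⟨hne.symm, Or.inr (Or.inr ⟨hx, h.symm⟩)⟩
    · exact ⟨hne.symm, Or.inr (Or.inl ⟨hy, h.symm⟩)⟩⟩
  loopless := ⟨fun _ h => h.1 rfl⟩

/-- `ReducesTo G G'`: the graph `G'` is obtained from `G` by a finite sequence of vertex deletions,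
edge deletions and edge contractions. -/
inductive ReducesTo {V : Type v} (G : SimpleGraph V) : {W : Type v} → SimpleGraph W → Prop
  | refl : ReducesTo G G
  | deleteVertex {W : Type v} {G' : SimpleGraph W} (w : W) :
      ReducesTo G G' → ReducesTo G (HypercubeMinors.deleteVertex G' w)
  | deleteEdge {W : Type v} {G' : SimpleGraph W} (e : Sym2 W) (he : e ∈ G'.edgeSet) :
      ReducesTo G G' → ReducesTo G (HypercubeMinors.deleteEdge G' e)
  | contractEdge {W : Type v} {G' : SimpleGraph W} (a b : W) (hab : G'.Adj a b) :
      ReducesTo G G' → ReducesTo G (HypercubeMinors.contractEdge G' a b)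

/-- `H` is a minor of `G`: up to isomorphism, `H` is obtained from `G` by a finite sequence of
edge and vertex deletions and edge contractions. -/
def IsMinor {U : Type u} {V : Type v} (H : SimpleGraph U) (G : SimpleGraph V) : Prop :=
  ∃ (W : Type v) (G' : SimpleGraph W), ReducesTo G G' ∧ Nonempty (H ≃g G')

/-- `G` is `m`-minor-universal: every graph with at most `m` edges and no isolated vertices is a
minor of `G`. -/
def IsMinorUniversal {V : Type v} (G : SimpleGraph V) (m : ℝ) : Prop :=
  ∀ (U : Type u) (H : SimpleGraph U),
    H.edgeSet.Finite → (H.edgeSet.ncard : ℝ) ≤ m → (∀ x, ∃ y, H.Adj x y) → IsMinor H G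

/-- The `d`-dimensional hypercube: binary strings of length `d`, adjacent when their Hamming
distance is one. -/
def hypercube (d : ℕ) : SimpleGraph (Fin d → Bool) where
  Adj x y := hammingDist x y = 1
  symm := ⟨fun x y h => by rw [hammingDist_comm]; exact h⟩
  loopless := ⟨fun x h => by simp at h⟩

end HypercubeMinors

/-! Write `d = k + l + 1`. A cyclic Gray code on `l` coordinates shows `Q_d` as `2 ^ l` layers,
cyclically ordered, each a copy of `Q_k` times an edge. In layer `0` the darts of `H` are placed
along a Gray code of `Q_k`, sorted by source, so the darts at a vertex form a path. Disjoint routes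
through the layers realise the involution reversing darts; the edge from the last layer back to
layer `0` then joins the route of `(u, w)` to the path of `w`. Contracting each path with its
outgoing routes gives `H` (`isMinor_of_labelling`).

Routing follows Beneš: a permutation of `X × Bool` is a fibre flip, a permutation of each copy of
`X`, and a fibre flip (`exists_flipOver_fibrewise`). By induction on `k`, any permutation of `Q_k`
needs only `O(k)` layers, so `2 ^ l` of order `d` suffices and `2 ^ k` has order `2 ^ d / d`. -/

namespace HypercubeMinors

open Relation

/-! ### Minors from vertex labellings. -/

section Reduction

variable {U : Type u} {V : Type v}

theorem ReducesTo.trans {G : SimpleGraph V} {W : Type v} {G' : SimpleGraph W}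
    (h : ReducesTo G G') {X : Type v} {G'' : SimpleGraph X} (h' : ReducesTo G' G'') :
    ReducesTo G G'' := by
  induction h' with
  | refl => exact h
  | deleteVertex w _ ih => exact .deleteVertex w ih
  | deleteEdge e he _ ih => exact .deleteEdge e he ih
  | contractEdge a b hab _ ih => exact .contractEdge a b hab ih

theorem IsMinor.of_reducesTo {H : SimpleGraph U} {G : SimpleGraph V} {W : Type v}
    {G' : SimpleGraph W} (h : ReducesTo G G') (hm : IsMinor H G') : IsMinor H G := by
  obtain ⟨X, G'', h', hi⟩ := hm
  exact ⟨X, G'', h.trans h', hi⟩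

theorem reducesTo_deleteEdges (G : SimpleGraph V) {s : Set (Sym2 V)} (hs : s.Finite) :
    s ⊆ G.edgeSet → ReducesTo G (G.deleteEdges s) := by
  induction s, hs using Set.Finite.induction_on with
  | empty => intro _; rw [SimpleGraph.deleteEdges_empty]; exact .refl
  | @insert e s he _ ih =>
    intro h
    have h1 := ih fun x hx => h (Set.mem_insert_of_mem _ hx)
    have h2 : e ∈ (G.deleteEdges s).edgeSet := by
      rw [SimpleGraph.edgeSet_deleteEdges]
      exact ⟨h (Set.mem_insert _ _), he⟩
    have h3 := ReducesTo.deleteEdge e h2 h1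
    rwa [HypercubeMinors.deleteEdge, SimpleGraph.deleteEdges_deleteEdges, Set.union_comm,
      ← Set.insert_eq] at h3

theorem reducesTo_of_le [Finite V] {G G' : SimpleGraph V} (h : G' ≤ G) : ReducesTo G G' := by
  have h1 := reducesTo_deleteEdges G (Set.toFinite (G.edgeSet \ G'.edgeSet)) Set.sdiff_subset
  have h2 : G.deleteEdges (G.edgeSet \ G'.edgeSet) = G' := by
    ext a b
    simp only [SimpleGraph.deleteEdges_adj, Set.mem_sdiff, SimpleGraph.mem_edgeSet]
    constructor
    · tauto
    · exact fun hab => ⟨h hab, by tauto⟩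
  rwa [h2] at h1

/-- Adjacent vertices carrying the same label. -/
def SameLabelAdj {L : Type*} (G : SimpleGraph V) (c : V → L) (a b : V) : Prop :=
  G.Adj a b ∧ c a = c b

instance {L : Type*} (G : SimpleGraph V) (c : V → L) : Std.Symm (SameLabelAdj G c) :=
  ⟨fun _ _ h => ⟨h.1.symm, h.2.symm⟩⟩

theorem ReflTransGen.label_eq {L : Type*} {G : SimpleGraph V} {c : V → L} {a b : V}
    (h : ReflTransGen (SameLabelAdj G c) a b) : c a = c b := by
  induction h with
  | refl => rfl
  | tail _ h ih => exact ih.trans h.2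

open Classical in
/-- The quotient map of the contraction of `b` into `a`. -/
noncomputable def contractMap {a b : V} (hab : a ≠ b) (x : V) : {x : V // x ≠ b} :=
  if h : x = b then ⟨a, hab⟩ else ⟨x, h⟩

theorem contractMap_adj {G : SimpleGraph V} {a b : V} (hab : a ≠ b) {x y : V} (h : G.Adj x y)
    (hne : contractMap hab x ≠ contractMap hab y) :
    (contractEdge G a b).Adj (contractMap hab x) (contractMap hab y) := by
  refine ⟨hne, ?_⟩
  have := h.ne
  unfold contractMap at hne ⊢
  split_ifs at hne ⊢ <;> simp_all

theorem label_contractMap {L : Type*} {c : V → L} {a b : V} (hab : a ≠ b) (hc : c a = c b)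
    (x : V) : c (contractMap hab x) = c x := by
  unfold contractMap
  split_ifs with h
  · rw [h, hc]
  · rfl

/-- A labelling of the vertices of `G` by vertices of `H`, in which the label class of each vertex
`u` of `H` has a component reaching those of all neighbours of `u`, exhibits `H` as a minor. -/
theorem isMinor_of_labelling [Finite V] (H : SimpleGraph U) (G : SimpleGraph V) (c : V → Option U)
    (r : U → V) (hr : ∀ u, c (r u) = some u)
    (hadj : ∀ u w, H.Adj u w → ∃ a b, G.Adj a b ∧ ReflTransGen (SameLabelAdj G c) (r u) a ∧
      ReflTransGen (SameLabelAdj G c) (r w) b) : IsMinor H G := by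
  induction hn : Nat.card V using Nat.strong_induction_on generalizing V with
  | _ n ih =>
  subst hn
  have hcard : ∀ b : V, Nat.card {x : V // x ≠ b} < Nat.card V := fun b =>
    Finite.card_subtype_lt (x := b) (by simp)
  -- Contract monochromatic edges while any exist. Then all monochromatic walks are trivial, so `r`
  -- preserves adjacency; vertices outside its range are deleted, and finally surplus edges.
  by_cases hm : ∃ a b, SameLabelAdj G c a b
  · obtain ⟨a, b, hab, hc⟩ := hm
    have hl := label_contractMap hab.ne hc
    refine .of_reducesTo (.contractEdge a b hab .refl)
      (ih _ (hcard b) _ (fun x => c x) (fun u => contractMap hab.ne (r u))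
        (fun u => (hl _).trans (hr u)) (fun u w huw => ?_) rfl)
    have hlift : ∀ {x y : V}, ReflTransGen (SameLabelAdj G c) x y →
        ReflTransGen (SameLabelAdj (contractEdge G a b) fun x => c x)
          (contractMap hab.ne x) (contractMap hab.ne y) := by
      intro x y h
      induction h with
      | refl => rfl
      | @tail y z _ h ih =>
        by_cases he : contractMap hab.ne y = contractMap hab.ne z
        · rwa [← he]
        · exact ih.tail ⟨contractMap_adj hab.ne h.1 he, (hl y).trans (h.2.trans (hl z).symm)⟩
    obtain ⟨x, y, hxy, hx, hy⟩ := hadj u w huw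
    refine ⟨_, _, contractMap_adj hab.ne hxy fun he => huw.ne ?_, hlift hx, hlift hy⟩
    have h1 := congrArg (fun z : {x : V // x ≠ b} => c z) he
    simp only [hl, ← ReflTransGen.label_eq hx, ← ReflTransGen.label_eq hy, hr] at h1
    exact Option.some_injective _ h1
  · have hrefl : ∀ {x y : V}, ReflTransGen (SameLabelAdj G c) x y → y = x := by
      intro x y h
      induction h with
      | refl => rfl
      | tail _ h _ => exact absurd ⟨_, _, h⟩ hm
    have hadj' : ∀ u w, H.Adj u w → G.Adj (r u) (r w) := by
      intro u w huw
      obtain ⟨x, y, hxy, hx, hy⟩ := hadj u w huw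
      rwa [hrefl hx, hrefl hy] at hxy
    by_cases hs : ∃ b, ∀ u, r u ≠ b
    · obtain ⟨b, hb⟩ := hs
      exact .of_reducesTo (.deleteVertex b .refl)
        (ih _ (hcard b) _ (fun x => c x) (fun u => ⟨r u, hb u⟩) hr
          (fun u w huw => ⟨⟨r u, hb u⟩, ⟨r w, hb w⟩, hadj' u w huw, .refl, .refl⟩) rfl)
    · push Not at hs
      have hinj : Function.Injective r := fun u w h =>
        Option.some_injective _ (by rw [← hr, ← hr, h])
      let e : U ≃ V := Equiv.ofBijective r ⟨hinj, hs⟩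
      refine ⟨V, H.map e, reducesTo_of_le ?_, ⟨SimpleGraph.Iso.map e H⟩⟩
      refine (SimpleGraph.map_le_iff_le_comap e.toEmbedding H G).2 ?_
      exact fun u w huw => hadj' u w huw

end Reduction

end HypercubeMinors
namespace HypercubeMinors

open Relation

/-! ### Beneš routing of permutations. -/

section Routing

/-- Two fixed-point-free involutions admit a common proper two-colouring. -/
theorem exists_two_colouring {Z : Type*} [Countable Z] (α β : Equiv.Perm Z) (hα : α * α = 1)
    (hβ : β * β = 1) (hα' : ∀ z, α z ≠ z) (hβ' : ∀ z, β z ≠ z) :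
    ∃ f : Z → Bool, ∀ z, f (α z) = !f z ∧ f (β z) = !f z := by
  have hαi : α⁻¹ = α := inv_eq_of_mul_eq_one_left hα
  have hβi : β⁻¹ = β := inv_eq_of_mul_eq_one_left hβ
  set π := α * β with hπ
  have hconj : ∀ n : ℤ, α * π ^ n = π ^ (-n) * α := by
    have h : α * π * α⁻¹ = π⁻¹ := by
      rw [hπ, mul_inv_rev, hαi, hβi, ← mul_assoc, hα, one_mul]
    intro n
    have h1 : α * π ^ n * α⁻¹ = π ^ (-n) := by rw [← conj_zpow, h, inv_zpow, zpow_neg]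
    rw [← h1, inv_mul_cancel_right]
  -- `α` inverts `π`, so `π ^ n z = α z` would make `π ^ m z` a fixed point of `α` if `n = 2m`, and
  -- of `β` if `n = 2m + 1`.
  have hne : ∀ z, ¬ π.SameCycle z (α z) := by
    rintro z ⟨n, hn⟩
    obtain ⟨m, rfl | rfl⟩ := Int.even_or_odd' n
    · refine hα' ((π ^ m) z) ?_
      have h1 : α ((π ^ m) z) = (π ^ (-m)) (α z) := DFunLike.congr_fun (hconj m) z
      rw [h1, ← hn, ← Equiv.Perm.mul_apply, ← zpow_add]
      congr 2
      ring
    · refine hβ' ((π ^ m) z) ?_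
      have h0 : β = α * π := by rw [hπ, ← mul_assoc, hα, one_mul]
      have h1 : α ((π ^ (m + 1)) z) = (π ^ (-(m + 1))) (α z) := DFunLike.congr_fun (hconj _) z
      rw [h0, Equiv.Perm.mul_apply, ← Equiv.Perm.mul_apply π, ← zpow_one_add, add_comm 1 m, h1,
        ← hn, ← Equiv.Perm.mul_apply, ← zpow_add]
      congr 2
      ring
  let S := Equiv.Perm.SameCycle.setoid π
  -- Both `α` and `β` exchange the `π`-cycles of `z` and `α z`. Numbering the cycles, the colour
  -- says which of the two comes first.
  obtain ⟨g, hg⟩ := exists_injective_nat (Quotient S)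
  let O : Z → ℕ := fun z => g (Quotient.mk S z)
  have hO : ∀ {x y}, π.SameCycle x y → O x = O y := fun h => congrArg g (Quotient.sound h)
  have hO' : ∀ z, O z ≠ O (α z) := fun z h => hne z (Quotient.exact (hg h))
  have hαα : ∀ z, α (α z) = z := fun z => DFunLike.congr_fun hα z
  have h1 : ∀ z, O (β z) = O (α z) := by
    intro z
    refine hO ⟨1, ?_⟩
    rw [zpow_one, hπ, Equiv.Perm.mul_apply, ← Equiv.Perm.mul_apply β, hβ, Equiv.Perm.one_apply]
  have h2 : ∀ z, O (α (β z)) = O z := fun z => (hO ⟨1, by rw [zpow_one]; rfl⟩).symm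
  refine ⟨fun z => decide (O z < O (α z)), fun z => ⟨?_, ?_⟩⟩
  · have := hO' z
    simp only [hαα, ← decide_not, decide_eq_decide]
    omega
  · have := hO' z
    simp only [h1, h2, ← decide_not, decide_eq_decide]
    omega

/-- The permutation of `X × Bool` flipping the second coordinate over the points selected
by `s`. -/
def flipOver {X : Type*} (s : X → Bool) : Equiv.Perm (X × Bool) :=
  Function.Involutive.toPerm (fun p => (p.1, p.2 ^^ s p.1)) fun p => by simp

@[simp]
theorem flipOver_apply {X : Type*} (s : X → Bool) (p : X × Bool) :
    flipOver s p = (p.1, p.2 ^^ s p.1) := rfl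

/-- A permutation of `X × Bool` preserving the second coordinate. -/
def fibrewise {X : Type*} (ρ : Bool → Equiv.Perm X) : Equiv.Perm (X × Bool) where
  toFun p := (ρ p.2 p.1, p.2)
  invFun p := ((ρ p.2).symm p.1, p.2)
  left_inv p := by simp
  right_inv p := by simp

/-- Colour the points so that two with the same initial fibre, or with images in the same fibre,
differ. The first flip moves each point to the copy named by its colour; `σ` then acts within copies
up to a final flip. -/
theorem exists_flipOver_fibrewise {X : Type*} [Finite X] (σ : Equiv.Perm (X × Bool)) :
    ∃ (s s' : X → Bool) (ρ : Bool → Equiv.Perm X),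
      σ = flipOver s' * (fibrewise ρ * flipOver s) := by
  set α : Equiv.Perm (X × Bool) := flipOver fun _ => true with hαdef
  have hα : α * α = 1 := by ext p <;> simp [hαdef]
  have hα' : ∀ z, α z ≠ z := fun z h => by
    have := congrArg Prod.snd h
    simp [hαdef] at this
  obtain ⟨f, hf⟩ := exists_two_colouring α (σ⁻¹ * α * σ) hα
    (by rw [show σ⁻¹ * α * σ * (σ⁻¹ * α * σ) = σ⁻¹ * (α * α) * σ by group, hα]; group) hα'
    (fun z h => hα' (σ z) (by
      have := congrArg σ h
      simpa using this))
  have hf1 : ∀ y j, f (y, !j) = !f (y, j) := fun y j => by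
    have := (hf (y, j)).1
    simpa [hαdef] using this
  have hf2 : ∀ y j, f (σ.symm (y, !j)) = !f (σ.symm (y, j)) := fun y j => by
    have := (hf (σ.symm (y, j))).2
    simpa [hαdef] using this
  let s : X → Bool := fun y => f (y, false)
  let s' : X → Bool := fun y => f (σ.symm (y, false))
  have hs : ∀ y j, f (y, j) = (j ^^ s y) := fun y j => by
    cases j
    · simp [s]
    · simpa [s] using hf1 y false
  have hs' : ∀ y j, f (σ.symm (y, j)) = (j ^^ s' y) := fun y j => by
    cases j
    · simp [s']
    · simpa [s'] using hf2 y false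
  let ψ : Equiv.Perm (X × Bool) := flipOver s' * σ * flipOver s
  have hψ : ∀ y j, (ψ (y, j)).2 = j := by
    intro y j
    have h1 := hs' (σ (y, j ^^ s y)).1 (σ (y, j ^^ s y)).2
    simp only [Prod.mk.eta, Equiv.symm_apply_apply, hs] at h1
    simp only [Bool.xor_assoc, Bool.xor_self, Bool.xor_false] at h1
    simpa [ψ] using h1.symm
  have hbij : ∀ j, Function.Bijective fun y => (ψ (y, j)).1 := fun j => by
    rw [← Finite.injective_iff_bijective]
    intro y y' h
    have : ψ (y, j) = ψ (y', j) := Prod.ext h (by rw [hψ, hψ])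
    simpa using this
  refine ⟨s, s', fun j => Equiv.ofBijective _ (hbij j), ?_⟩
  have hψ' : fibrewise (fun j => Equiv.ofBijective _ (hbij j)) = ψ := by
    ext p
    · simp [fibrewise]
    · simp [fibrewise, hψ p.1 p.2]
  have hinv : ∀ t : X → Bool, flipOver t * flipOver t = 1 := fun t => by
    ext p <;> simp
  rw [hψ', show flipOver s' * (flipOver s' * σ * flipOver s * flipOver s) =
    (flipOver s' * flipOver s') * σ * (flipOver s * flipOver s) by group, hinv, hinv]
  simp

variable {X Y : Type*}

/-- A step in the product of `G`, an edge and a directed path of time layers, staying within the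
layers `0, …, n` and within one class of the labelling `c`. -/
def RouteStep {L : Type*} (G : SimpleGraph X) (n : ℕ) (c : X × Bool × ℕ → L)
    (p q : X × Bool × ℕ) : Prop :=
  q.2.2 ≤ n ∧ c p = c q ∧
    ((G.Adj p.1 q.1 ∧ p.2 = q.2) ∨ (p.1 = q.1 ∧ p.2.1 ≠ q.2.1 ∧ p.2.2 = q.2.2) ∨
      (p.1 = q.1 ∧ p.2.1 = q.2.1 ∧ q.2.2 = p.2.2 + 1))

/-- The permutation `σ` is realised by disjoint routes from layer `0` to layer `n`; the routes are
given as the classes of a labelling. -/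
def Routable (G : SimpleGraph X) (n : ℕ) (σ : Equiv.Perm X) : Prop :=
  ∃ c : X × Bool × ℕ → X, ∀ x, c (x, false, 0) = x ∧
    ReflTransGen (RouteStep G n c) (x, false, 0) (σ x, false, n)

theorem RouteStep.reflTransGen_label_eq {L : Type*} {G : SimpleGraph X} {n : ℕ}
    {c : X × Bool × ℕ → L} {p q : X × Bool × ℕ} (h : ReflTransGen (RouteStep G n c) p q) :
    c p = c q := by
  induction h with
  | refl => rfl
  | tail _ h ih => exact ih.trans h.2.1

theorem routable_one (G : SimpleGraph X) (n : ℕ) : Routable G n 1 := by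
  refine ⟨fun p => p.1, fun x => ⟨rfl, ?_⟩⟩
  have h : ∀ m ≤ n, ReflTransGen (RouteStep G n fun p => p.1) (x, false, 0) (x, false, m) := by
    intro m hm
    induction m with
    | zero => rfl
    | succ m ih => exact (ih (by omega)).tail ⟨hm, rfl, by simp⟩
  exact h n le_rfl

theorem Routable.mul {G : SimpleGraph X} {n m : ℕ} {σ τ : Equiv.Perm X} (hτ : Routable G m τ)
    (hσ : Routable G n σ) : Routable G (n + m + 1) (τ * σ) := by
  obtain ⟨c, hc⟩ := hσ
  obtain ⟨c', hc'⟩ := hτ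
  -- The route entering the second stage at `σ x` must keep its label `x`, hence `σ.symm`.
  let C : X × Bool × ℕ → X := fun p =>
    if p.2.2 ≤ n then c p else σ.symm (c' (p.1, p.2.1, p.2.2 - (n + 1)))
  have hC : ∀ p : X × Bool × ℕ, p.2.2 ≤ n → C p = c p := fun p hp => if_pos hp
  have hC' : ∀ p : X × Bool × ℕ, C (p.1, p.2.1, p.2.2 + (n + 1)) = σ.symm (c' p) := fun p => by
    have : ¬ p.2.2 + (n + 1) ≤ n := by omega
    simp [C, this]
  refine ⟨C, fun x => ⟨(hC _ (Nat.zero_le _)).trans (hc x).1, ?_⟩⟩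
  have h1 : ReflTransGen (RouteStep G (n + m + 1) C) (x, false, 0) (σ x, false, n) := by
    refine ReflTransGen.mono ?_ _ _ (hc x).2
    rintro p q ⟨h, hl, ha⟩
    have hp : p.2.2 ≤ n := by
      rcases ha with ha | ha | ha
      · rw [ha.2]; exact h
      · rw [ha.2.2]; exact h
      · omega
    exact ⟨by omega, by rw [hC _ hp, hC _ h, hl], ha⟩
  have h2 : RouteStep G (n + m + 1) C (σ x, false, n) (σ x, false, 0 + (n + 1)) := by
    refine ⟨by simp only; omega, ?_, by simp⟩
    rw [hC _ le_rfl, hC' (σ x, false, 0), (hc' _).1, ← RouteStep.reflTransGen_label_eq (hc x).2,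
      (hc x).1, Equiv.symm_apply_apply]
  have h3 : ReflTransGen (RouteStep G (n + m + 1) C) (σ x, false, 0 + (n + 1))
      (τ (σ x), false, m + (n + 1)) := by
    refine ReflTransGen.lift (fun p : X × Bool × ℕ => (p.1, p.2.1, p.2.2 + (n + 1))) ?_
      _ _ (hc' (σ x)).2
    rintro p q ⟨h, hl, ha⟩
    refine ⟨by simp only; omega, by rw [hC', hC', hl], ?_⟩
    rcases ha with ha | ha | ha
    · exact Or.inl ⟨ha.1, by simp [ha.2]⟩
    · exact Or.inr (Or.inl ⟨ha.1, ha.2.1, by simp [ha.2.2]⟩)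
    · exact Or.inr (Or.inr ⟨ha.1, ha.2.1, by simp only; omega⟩)
  have h4 := (h1.tail h2).trans h3
  rwa [show m + (n + 1) = n + m + 1 by omega] at h4

theorem Routable.congr {G : SimpleGraph X} {G' : SimpleGraph Y} {n : ℕ} (e : G ≃g G')
    {σ : Equiv.Perm Y} (h : Routable G n (e.toEquiv.permCongr.symm σ)) : Routable G' n σ := by
  obtain ⟨c, hc⟩ := h
  refine ⟨fun p => e (c (e.symm p.1, p.2)), fun y => ⟨by simp [(hc _).1], ?_⟩⟩
  have := ReflTransGen.lift (r := RouteStep G n c)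
    (p := RouteStep G' n fun p => e (c (e.symm p.1, p.2)))
    (fun p : X × Bool × ℕ => (e p.1, p.2)) ?_ _ _ (hc (e.symm y)).2
  · have he : e.toEquiv.permCongr.symm σ (e.symm y) = e.symm (σ y) :=
      congrArg (fun z => e.symm (σ z)) (e.apply_symm_apply y)
    rw [Function.onFun, he] at this
    simpa only [e.apply_symm_apply] using this
  · rintro p q ⟨h, hl, ha⟩
    refine ⟨h, by simp [hl], ?_⟩
    simpa [e.map_adj_iff] using ha

/-- The auxiliary `Bool` lets two routes pass: over a flipped fibre, the one from `false` uses side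
`true` throughout, while the other crosses on side `false` in layer `1`. -/
theorem routable_flipOver (G : SimpleGraph X) (s : X → Bool) :
    Routable (G.boxProd (⊤ : SimpleGraph Bool)) 2 (flipOver s) := by
  let c : (X × Bool) × Bool × ℕ → X × Bool := fun p =>
    (p.1.1, if s p.1.1 then (if p.2.1 then false else
      if p.2.2 = 0 then p.1.2 else if p.2.2 = 1 then true else !p.1.2) else p.1.2)
  refine ⟨c, fun ⟨y, j⟩ => ⟨by simp [c], ?_⟩⟩
  by_cases hs : s y = true
  · cases j
    · refine ReflTransGen.head (b := ((y, false), true, 0)) ?_ <|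
        ReflTransGen.head (b := ((y, true), true, 0)) ?_ <|
        ReflTransGen.head (b := ((y, true), true, 1)) ?_ <|
        ReflTransGen.head (b := ((y, true), true, 2)) ?_ <|
        ReflTransGen.single ?_ <;>
      simp [RouteStep, c, hs]
    · refine ReflTransGen.head (b := ((y, true), false, 1)) ?_ <|
        ReflTransGen.head (b := ((y, false), false, 1)) ?_ <|
        ReflTransGen.single ?_ <;>
      simp [RouteStep, c, hs]
  · refine ReflTransGen.head (b := ((y, j), false, 1)) ?_ <| ReflTransGen.single ?_ <;>
      simp [RouteStep, c, hs]

theorem routable_fibrewise {G : SimpleGraph X} {n : ℕ} {ρ : Bool → Equiv.Perm X}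
    (h : ∀ j, Routable G n (ρ j)) :
    Routable (G.boxProd (⊤ : SimpleGraph Bool)) n (fibrewise ρ) := by
  choose c hc using h
  refine ⟨fun p => (c p.1.2 (p.1.1, p.2), p.1.2), fun ⟨y, j⟩ => ⟨by simp [(hc _ _).1], ?_⟩⟩
  refine ReflTransGen.lift (fun p : X × Bool × ℕ => ((p.1, j), p.2)) ?_ _ _ (hc j y).2
  rintro p q ⟨h, hl, ha⟩
  refine ⟨h, by simp [hl], ?_⟩
  simpa using ha

theorem routable_boxProd [Finite X] {G : SimpleGraph X} {n : ℕ} (h : ∀ σ, Routable G n σ)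
    (σ : Equiv.Perm (X × Bool)) :
    Routable (G.boxProd (⊤ : SimpleGraph Bool)) (n + 6) σ := by
  obtain ⟨s, s', ρ, rfl⟩ := exists_flipOver_fibrewise σ
  -- Two layers for each flip and one for each junction make the `6`.
  have := (routable_flipOver G s').mul
    ((routable_fibrewise fun j => h (ρ j)).mul (routable_flipOver G s))
  rwa [show 2 + n + 1 + 2 + 1 = n + 6 by omega] at this

end Routing

/-! ### Product structure and Gray codes of hypercubes. -/

section Hypercube

theorem hammingDist_cons {n : ℕ} (a b : Bool) (x y : Fin n → Bool) :
    hammingDist (Fin.cons a x : Fin (n + 1) → Bool) (Fin.cons b y) =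
      (if a = b then 0 else 1) + hammingDist x y := by
  simp [hammingDist, Finset.card_filter, Fin.sum_univ_succ]

theorem hammingDist_append {m n : ℕ} (a b : Fin m → Bool) (x y : Fin n → Bool) :
    hammingDist (Fin.append a x) (Fin.append b y) = hammingDist a b + hammingDist x y := by
  simp [hammingDist, Finset.card_filter, Fin.sum_univ_add]

/-- Splitting off the first coordinate of a hypercube. -/
def hypercubeSuccIso (k : ℕ) :
    (hypercube k).boxProd (⊤ : SimpleGraph Bool) ≃g hypercube (k + 1) where
  toEquiv := (Equiv.prodComm _ _).trans (Fin.consEquiv fun _ => Bool)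
  map_rel_iff' := by
    rintro ⟨x, a⟩ ⟨y, b⟩
    by_cases h : a = b
    · simp [hypercube, hammingDist_cons, Fin.consEquiv, h]
    · simp [hypercube, hammingDist_cons, Fin.consEquiv, h]

theorem routable_hypercube (k : ℕ) (σ : Equiv.Perm (Fin k → Bool)) :
    Routable (hypercube k) (6 * k) σ := by
  induction k with
  | zero =>
    rw [Subsingleton.elim σ 1]
    exact routable_one _ _
  | succ k ih => exact (routable_boxProd ih _).congr (hypercubeSuccIso k)

/-- A cyclic Gray code. -/
theorem exists_gray_code (l : ℕ) : ∃ g : ℕ → Fin l → Bool,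
    (∀ i < 2 ^ l, ∀ j < 2 ^ l, g i = g j → i = j) ∧
    (∀ i, i + 1 < 2 ^ l → (hypercube l).Adj (g i) (g (i + 1))) ∧
    (1 ≤ l → (hypercube l).Adj (g (2 ^ l - 1)) (g 0)) := by
  induction l with
  | zero => exact ⟨fun _ _ => false, by simp, by simp, by simp⟩
  | succ l ih =>
    obtain ⟨g, hinj, hadj, -⟩ := ih
    have hpos : 0 < 2 ^ l := by positivity
    have hpow : 2 ^ (l + 1) = 2 * 2 ^ l := by ring
    -- Reflected code: the old code, then its reversal with the new bit set.
    refine ⟨fun i => if i < 2 ^ l then Fin.cons false (g i) else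
      Fin.cons true (g (2 * 2 ^ l - 1 - i)), ?_, ?_, ?_⟩
    · intro i hi j hj h
      dsimp only at h
      split_ifs at h with h1 h2 h2 <;> rw [Fin.cons_inj] at h
      · exact hinj _ h1 _ h2 h.2
      · simp at h
      · simp at h
      · have := hinj _ (by omega) _ (by omega) h.2
        omega
    · intro i hi
      dsimp only
      rcases lt_trichotomy (i + 1) (2 ^ l) with h | h | h
      · have := hadj i h
        rw [if_pos (by omega), if_pos h]
        simpa [hypercube, hammingDist_cons] using this
      · rw [if_pos (by omega), if_neg (by omega), show 2 * 2 ^ l - 1 - (i + 1) = i by omega]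
        simp [hypercube, hammingDist_cons]
      · have := (hadj (2 * 2 ^ l - 1 - (i + 1)) (by omega)).symm
        rw [show 2 * 2 ^ l - 1 - (i + 1) + 1 = 2 * 2 ^ l - 1 - i by omega] at this
        rw [if_neg (by omega), if_neg (by omega)]
        simpa [hypercube, hammingDist_cons] using this
    · intro _
      dsimp only
      rw [if_neg (by omega), if_pos hpos, hpow, Nat.sub_self]
      simp [hypercube, hammingDist_cons]

end Hypercube

end HypercubeMinors
namespace HypercubeMinors

open Relation

/-! ### Embedding `H` and counting. -/

section Embedding

variable {U : Type u}

/-- A finite family of points can be placed in a hypercube so that the members of each fibre of `π`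
are connected by the points of that fibre. -/
theorem exists_placement {P : Type*} [Finite P] (π : P → U) (k : ℕ) (hP : Nat.card P ≤ 2 ^ k) :
    ∃ (f : P ↪ (Fin k → Bool)) (D : (Fin k → Bool) → Option U), (∀ p, D (f p) = some (π p)) ∧
      ∀ p q, π p = π q → ReflTransGen (SameLabelAdj (hypercube k) D) (f p) (f q) := by
  classical
  let : LinearOrder U := linearOrderOfSTO WellOrderingRel
  obtain ⟨g, hinj, hadj, -⟩ := exists_gray_code k
  let e₀ : Fin (Nat.card P) ≃ P := (Finite.equivFin P).symm
  -- Sorting by `π` makes every fibre an interval of the Gray code.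
  let e : Fin (Nat.card P) ≃ P := (Tuple.sort (π ∘ e₀)).trans e₀
  have he : Monotone (π ∘ e) := Tuple.monotone_sort (π ∘ e₀)
  let f : P ↪ (Fin k → Bool) := ⟨fun p => g (e.symm p), fun p q h => e.symm.injective <| Fin.ext <|
    hinj _ ((e.symm p).2.trans_le hP) _ ((e.symm q).2.trans_le hP) h⟩
  let D : (Fin k → Bool) → Option U := Function.extend f (fun p => some (π p)) fun _ => none
  have hD : ∀ p, D (f p) = some (π p) := fun p => f.injective.extend_apply _ _ p
  have hf : ∀ i, f (e i) = g i := fun i =>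
    congrArg (fun j : Fin _ => g j) (e.symm_apply_apply i)
  have hlink : ∀ (i : Fin (Nat.card P)) (j : ℕ) (hj : j < Nat.card P), (i : ℕ) ≤ j →
      π (e i) = π (e ⟨j, hj⟩) →
      ReflTransGen (SameLabelAdj (hypercube k) D) (f (e i)) (f (e ⟨j, hj⟩)) := by
    intro i j
    induction j with
    | zero =>
      intro hj hij _
      rw [show i = ⟨0, hj⟩ from Fin.ext (by simpa using hij)]
    | succ j ih =>
      intro hj hij hπ
      rcases hij.eq_or_lt with h | h
      · rw [show i = ⟨j + 1, hj⟩ from Fin.ext h]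
      · have hij' : (i : ℕ) ≤ j := by omega
        have h1 : π (e i) ≤ π (e ⟨j, by omega⟩) := he (show i ≤ ⟨j, _⟩ from hij')
        have h2 : π (e ⟨j, by omega⟩) ≤ π (e ⟨j + 1, hj⟩) :=
          he (show (⟨j, _⟩ : Fin _) ≤ ⟨j + 1, hj⟩ from Nat.le_succ j)
        have h3 : π (e i) = π (e ⟨j, by omega⟩) := le_antisymm h1 (hπ ▸ h2)
        refine (ih (by omega) hij' h3).tail ⟨?_, by rw [hD, hD, ← h3, hπ]⟩
        rw [hf, hf]
        exact hadj j (by omega)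
  have hlink' : ∀ i j, π (e i) = π (e j) →
      ReflTransGen (SameLabelAdj (hypercube k) D) (f (e i)) (f (e j)) := by
    intro i j h
    rcases le_total (i : ℕ) j with hij | hij
    · exact hlink i j j.2 hij h
    · exact symm (hlink j i i.2 hij h.symm)
  refine ⟨f, D, hD, fun p q h => ?_⟩
  have := hlink' (e.symm p) (e.symm q) (by simpa using h)
  simpa using this

theorem finite_of_finite_edgeSet {H : SimpleGraph U} (hfin : H.edgeSet.Finite)
    (hiso : ∀ x, ∃ y, H.Adj x y) : Finite U := by
  rw [← Set.finite_univ_iff]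
  refine (hfin.biUnion (t := fun e => {x | x ∈ e}) fun e _ => ?_).subset fun x _ => ?_
  · induction e with
    | _ a b => exact (Set.toFinite {a, b}).subset fun x hx => by simpa using hx
  · obtain ⟨y, hy⟩ := hiso x
    exact Set.mem_biUnion (H.mem_edgeSet.2 hy) (Sym2.mem_mk_left x y)

theorem card_dart {H : SimpleGraph U} [Finite U] : Nat.card H.Dart = 2 * H.edgeSet.ncard := by
  classical
  have := Fintype.ofFinite U
  rw [Nat.card_eq_fintype_card, H.dart_card_eq_twice_card_edges, Set.ncard_eq_toFinset_card']
  rfl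

theorem isMinor_hypercube (H : SimpleGraph U) (hfin : H.edgeSet.Finite)
    (hiso : ∀ x, ∃ y, H.Adj x y) {k l : ℕ} (hk : 2 * H.edgeSet.ncard ≤ 2 ^ k)
    (hl : 6 * k + 2 ≤ 2 ^ l) : IsMinor H (hypercube (k + l + 1)) := by
  classical
  have := finite_of_finite_edgeSet hfin hiso
  have := Fintype.ofFinite U
  obtain ⟨f, D, hD, hlink⟩ := exists_placement (fun p : H.Dart => p.fst) k (card_dart.trans_le hk)
  let ι : Equiv.Perm H.Dart := SimpleGraph.Dart.symm_involutive.toPerm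
  let σ : Equiv.Perm (Fin k → Bool) := ι.viaFintypeEmbedding f
  have hσ : ∀ p : H.Dart, σ (f p) = f p.symm := fun p => ι.viaFintypeEmbedding_apply_image f p
  obtain ⟨n, hn⟩ : ∃ n, 2 ^ l = n + 1 := ⟨2 ^ l - 1, by omega⟩
  have hroute : Routable (hypercube k) n σ := by
    -- Idle layers pad the routing to end exactly in the last layer `n`; the junction accounts for
    -- the `- 1`.
    have := (routable_one (hypercube k) (n - 6 * k - 1)).mul (routable_hypercube k σ)
    rwa [one_mul, show 6 * k + (n - 6 * k - 1) + 1 = n by omega] at this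
  obtain ⟨c, hc⟩ := hroute
  obtain ⟨g, hinj, hadj, hcyc⟩ := exists_gray_code l
  have hl1 : 1 ≤ l := by
    rcases Nat.eq_zero_or_pos l with rfl | h
    · simp at hl
    · exact h
  rw [hn] at hinj hadj hcyc
  let Φ : (Fin k → Bool) × Bool × ℕ → Fin (k + l + 1) → Bool := fun p =>
    Fin.cons p.2.1 (Fin.append p.1 (g p.2.2))
  have hΦ : ∀ p q, (hypercube (k + l + 1)).Adj (Φ p) (Φ q) ↔ (if p.2.1 = q.2.1 then 0 else 1) +
      (hammingDist p.1 q.1 + hammingDist (g p.2.2) (g q.2.2)) = 1 := fun p q => by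
    simp [hypercube, Φ, hammingDist_cons, hammingDist_append]
  -- A route inherits the source of its dart; `invFunOn` recovers the layer from its Gray word.
  let L : (Fin (k + l + 1) → Bool) → Option U := fun v =>
    D (c (fun i => v (Fin.castAdd l i).succ, v 0,
      Function.invFunOn g (Set.Iio (n + 1)) fun j => v (Fin.natAdd k j).succ))
  have hL : ∀ p : (Fin k → Bool) × Bool × ℕ, p.2.2 ≤ n → L (Φ p) = D (c p) := by
    rintro ⟨x, b, t⟩ ht
    have hinv : Function.invFunOn g (Set.Iio (n + 1)) (g t) = t :=
      Set.InjOn.leftInvOn_invFunOn (fun i hi j hj h => hinj i hi j hj h) (Nat.lt_succ_of_le ht)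
    simp [L, Φ, hinv]
  have hstep : ∀ p q, RouteStep (hypercube k) n c p q →
      SameLabelAdj (hypercube (k + l + 1)) L (Φ p) (Φ q) := by
    rintro ⟨x, b, t⟩ ⟨y, b', t'⟩ ⟨h, hl, ha⟩
    simp only [Prod.mk.injEq] at h ha
    refine ⟨?_, ?_⟩
    · rw [hΦ]
      rcases ha with ⟨ha, rfl, rfl⟩ | ⟨rfl, hb, rfl⟩ | ⟨rfl, rfl, rfl⟩
      · have : hammingDist x y = 1 := ha
        simp [this]
      · simp [hb]
      · have : hammingDist (g t) (g (t + 1)) = 1 := hadj t (by omega)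
        simp [this]
    · rw [hL _ (by simp only; omega), hL _ h, hl]
  have hbase : ∀ x y, SameLabelAdj (hypercube k) D x y →
      SameLabelAdj (hypercube (k + l + 1)) L (Φ (x, false, 0)) (Φ (y, false, 0)) := by
    rintro x y ⟨ha, hl⟩
    refine ⟨?_, by rw [hL _ (Nat.zero_le _), hL _ (Nat.zero_le _), (hc x).1, (hc y).1, hl]⟩
    have : hammingDist x y = 1 := ha
    simp [hΦ, this]
  have hbase' : ∀ p q : H.Dart, p.fst = q.fst → ReflTransGen
      (SameLabelAdj (hypercube (k + l + 1)) L) (Φ (f p, false, 0)) (Φ (f q, false, 0)) :=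
    fun p q h => ReflTransGen.lift (fun x => Φ (x, false, 0)) hbase _ _ (hlink p q h)
  choose nb hnb using hiso
  let root : U → H.Dart := fun u => ⟨(u, nb u), hnb u⟩
  refine isMinor_of_labelling H _ L (fun u => Φ (f (root u), false, 0)) (fun u => ?_) ?_
  · rw [hL _ (Nat.zero_le _), (hc _).1, hD]
  · intro u w huw
    let p : H.Dart := ⟨(u, w), huw⟩
    -- The closing edge of the cyclic code meets the end of the route of `p`.
    refine ⟨Φ (f p.symm, false, n), Φ (f p.symm, false, 0), ?_, ?_, hbase' _ _ rfl⟩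
    · have : hammingDist (g n) (g 0) = 1 := hcyc hl1
      simp [hΦ, this]
    · have h := ReflTransGen.lift Φ hstep _ _ (hc (f p)).2
      rw [Function.onFun, hσ] at h
      exact (hbase' (root u) p rfl).trans h

end Embedding

end HypercubeMinors

theorem mainTheorem2 :
    ∃ c : ℝ, 0 < c ∧ ∀ d : ℕ, 1 ≤ d →
      HypercubeMinors.IsMinorUniversal.{u} (HypercubeMinors.hypercube d)
        (c * (2 : ℝ) ^ d / (d : ℝ)) := by
  -- With `2 ^ l ≤ 16 * d`, one gets `2 ^ k ≥ 2 ^ d / (32 * d)`, which must be at least twice the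
  -- number of edges.
  refine ⟨1 / 64, by norm_num, fun d hd U H hfin hm hiso => ?_⟩
  have hd0 : (0 : ℝ) < d := by exact_mod_cast hd
  have hm' : 64 * d * H.edgeSet.ncard ≤ 2 ^ d := by
    rw [le_div_iff₀ hd0] at hm
    have : (64 * d * H.edgeSet.ncard : ℝ) ≤ 2 ^ d := by linarith
    exact_mod_cast this
  obtain ⟨l, hl1, hl2⟩ : ∃ l, 8 * d < 2 ^ l ∧ 2 ^ l ≤ 16 * d := by
    refine ⟨Nat.log 2 (8 * d) + 1, Nat.lt_pow_succ_log_self one_lt_two _, ?_⟩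
    have := Nat.pow_log_le_self 2 (x := 8 * d) (by omega)
    rw [pow_succ]
    omega
  -- An edge is needed for `l < d`: it gives `2 ^ l ≤ 16 * d < 64 * d ≤ 2 ^ d`.
  rcases Nat.eq_zero_or_pos H.edgeSet.ncard with h0 | h0
  · have hempty : IsEmpty U := ⟨fun x => by
      obtain ⟨y, hy⟩ := hiso x
      have := (Set.ncard_eq_zero hfin).1 h0
      exact (this ▸ H.mem_edgeSet.2 hy : s(x, y) ∈ (∅ : Set (Sym2 U)))⟩
    exact HypercubeMinors.isMinor_of_labelling H _ (fun _ => none) isEmptyElim isEmptyElim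
      isEmptyElim
  · have hld : l < d := by
      rw [← Nat.pow_lt_pow_iff_right one_lt_two]
      nlinarith
    obtain ⟨k, rfl⟩ : ∃ k, d = k + l + 1 := ⟨d - l - 1, by omega⟩
    refine HypercubeMinors.isMinor_hypercube H hfin hiso ?_ (by omega)
    have h1 : 2 ^ (k + l + 1) = 2 * 2 ^ k * 2 ^ l := by ring
    have h2 : 2 * 2 ^ k * 2 ^ l ≤ 2 * 2 ^ k * (16 * (k + l + 1)) := Nat.mul_le_mul_left _ hl2
    have h3 : 32 * (k + l + 1) * (2 * H.edgeSet.ncard) ≤ 32 * (k + l + 1) * 2 ^ k := by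
      calc _ = 64 * (k + l + 1) * H.edgeSet.ncard := by ring
        _ ≤ _ := hm'
        _ ≤ _ := h1.trans_le h2
        _ = _ := by ring
    exact Nat.le_of_mul_le_mul_left h3 (by omega)
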